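/- Theorem 1.1. For nonnegative integers $a,b,c$ let $H(a,b,c)$ be the hexagon on the triangular lattice (unit side, one of the lattice line directions horizontal) with all angles equal to $120^\circ$ whose sides, counterclockwise from the bottom one, have lengths $b,a,c,b,a,c$. Let $H_{\mathrm d}(a,b,c)$ be the region obtained from $H(a,b,c)$ by removing the maximal staircases of lozenges at its northwestern corner (where the top side, of length $b$, meets a side of length $a$) and at its eastern corner (where a side of length $a$ meets a side of length $c$). Here the maximal staircase at a corner where sides of lengths $p$ and $q$ meet is the triangular array of unit lozenges with sides parallel to these two sides of the hexagon, consisting of rows of $m-1,m-2,\dots,1$ lozenges, $m=\min(p,q)$, the first row running along one of the two sides and all rows starting at the other one, the first of them at the corner. For a region $R$ on the triangular lattice let $L(R)$ be the number of its lozenge tilings, i.e. of the tilings of $R$ by unit rhombi each of which is the union of two unit lattice triangles sharing a side. If $b\le a\le c$, then $$L(H_{\mathrm d}(a,b,c))=(-1)^{b(b+1)/2}\,P_b(a-2b-1,\,b+c+1),$$ where $$P_n(x,y)=\prod_{j=1}^{n}\frac{(j-1)!\,(x+y+2j)!\,(x-y+2j+1)_j\,(x+2y+3j+1)_{n-j}}{(x+n+2j)!\,(y+n-j)!}$$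 and $(\alpha)_k=\alpha(\alpha+1)\cdots(\alpha+k-1)$ for $k\ge 1$, $(\alpha)_0=1$. -/

import Mathlib

/-!
Coordinates on the triangular lattice: the integer pair `(x, y)` stands for the lattice point
`x • e + y • f`, where `e = (1, 0)` points east and `f = (1/2, √3/2)` points sixty degrees north
of east. The third lattice direction is `f - e`, sixty degrees north of west.
-/

/-- A unit triangle of the triangular lattice.
`up x y` has the horizontal edge from `(x, y)` to `(x + 1, y)` as its bottom side, and
`down x y` has the horizontal edge from `(x, y + 1)` to `(x + 1, y + 1)` as its top side. -/
inductive UnitTriangle : Type where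
  | up (x y : ℤ) : UnitTriangle
  | down (x y : ℤ) : UnitTriangle

namespace UnitTriangle

/-- The three vertices of a unit triangle. -/
def vertices : UnitTriangle → Finset (ℤ × ℤ)
  | up x y => {(x, y), (x + 1, y), (x, y + 1)}
  | down x y => {(x + 1, y), (x, y + 1), (x + 1, y + 1)}

/-- Two unit triangles are adjacent when they have exactly two common vertices, that is, when they
are distinct and share a side. -/
def Adjacent (s t : UnitTriangle) : Prop :=
  (s.vertices ∩ t.vertices).card = 2

end UnitTriangle

/-- A lozenge: a unit rhombus with angles of 60 and 120 degrees, i.e. the union of two unit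
triangles that share a side. Regions on the triangular lattice are given by the set of unit
triangles that they consist of. -/
def IsLozenge (L : Set UnitTriangle) : Prop :=
  ∃ s t : UnitTriangle, s.Adjacent t ∧ L = {s, t}

/-- `T` is a lozenge tiling of the region `R`: a set of lozenges without overlaps whose union
is `R`. -/
def IsLozengeTiling (R : Set UnitTriangle) (T : Set (Set UnitTriangle)) : Prop :=
  (∀ L ∈ T, IsLozenge L) ∧ T.PairwiseDisjoint id ∧ ⋃₀ T = R

/-- A finite region has finitely many lozenge tilings. -/
theorem finite_setOf_isLozengeTiling {R : Set UnitTriangle} (hR : R.Finite) :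
    {T | IsLozengeTiling R T}.Finite := by
  refine hR.finite_subsets.finite_subsets.subset ?_
  rintro T ⟨-, -, hT⟩ L hL
  exact hT ▸ Set.subset_sUnion_of_mem hL

/-- The number `L(R)` of lozenge tilings of a (finite) region `R`. -/
noncomputable def numLozengeTilings (R : Set UnitTriangle) : ℕ :=
  {T | IsLozengeTiling R T}.ncard

/-- The lattice points of the hexagon `H(a, b, c)` with angles of 120 degrees. Its vertices are
`(0, 0)`, `(b, 0)`, `(b, a)`, `(b - c, a + c)`, `(-c, a + c)` and `(-c, c)`, counterclockwise from
the southwestern one. So the horizontal sides have length `b`, the southeastern and the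
northwestern side have length `a`, the northeastern and the southwestern side have length `c`. -/
def hexagonPoints (a b c : ℕ) : Set (ℤ × ℤ) :=
  {p | -(c : ℤ) ≤ p.1 ∧ p.1 ≤ b ∧ 0 ≤ p.2 ∧ p.2 ≤ a + c ∧ 0 ≤ p.1 + p.2 ∧ p.1 + p.2 ≤ a + b}

/-- The hexagon `H(a, b, c)`: the unit triangles all of whose vertices belong to it. -/
def hexagon (a b c : ℕ) : Set UnitTriangle :=
  {t | ∀ p ∈ t.vertices, p ∈ hexagonPoints a b c}

/-- The maximal staircase of lozenges at the northwestern corner `(-c, a + c)` of `H(a, b, c)`,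
where sides of lengths `b` (horizontal) and `a` meet. With `m = min a b`, it has rows of
`m - 1, m - 2, …, 1` lozenges with sides parallel to these two sides of the hexagon: the lozenge
that is `r` steps to the east and `s` steps down the northwestern side from the one
in the corner belongs to it if and only if `r + s + 2 ≤ m`. -/
def northwestStaircase (a b c : ℕ) : Set UnitTriangle :=
  {t | ∃ r s : ℕ, r + s + 2 ≤ min a b ∧
    (t = .up (-c + r) (a + c - 1 - s) ∨ t = .down (-c + r) (a + c - 1 - s))}

/-- The maximal staircase of lozenges at the eastern corner `(b, a)` of `H(a, b, c)`, where the
southeastern side of length `a` and the northeastern side of length `c` meet. With `m = min a c`,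
it has rows of `m - 1, m - 2, …, 1` lozenges with sides parallel to these two sides of the hexagon:
the lozenge that is `r` steps down the southeastern side and `s` steps up the northeastern
side from the one in the corner belongs to it if and only if `r + s + 2 ≤ m`. -/
def eastStaircase (a b c : ℕ) : Set UnitTriangle :=
  {t | ∃ r s : ℕ, r + s + 2 ≤ min a c ∧
    (t = .up (b - 1 - s) (a - r + s) ∨ t = .down (b - 1 - s) (a - 1 - r + s))}

/-- The region `H_d(a, b, c)`: the hexagon `H(a, b, c)` with the maximal staircases at its
northwestern and eastern corners removed. -/
def hexagonD (a b c : ℕ) : Set UnitTriangle :=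
  hexagon a b c \ (northwestStaircase a b c ∪ eastStaircase a b c)

/-- The region `H_d(a, b, c)` is finite. -/
theorem hexagonD_finite (a b c : ℕ) : (hexagonD a b c).Finite := by
  let B : Set (ℤ × ℤ) := Set.Icc (-(c : ℤ) - 1) b ×ˢ Set.Icc (-1) ((a : ℤ) + c)
  have hB : B.Finite := (Set.finite_Icc _ _).prod (Set.finite_Icc _ _)
  refine ((hB.image fun p => UnitTriangle.up p.1 p.2).union
    (hB.image fun p => UnitTriangle.down p.1 p.2)).subset ?_
  rintro (⟨x, y⟩ | ⟨x, y⟩) ⟨ht, -⟩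
  · have h := ht (x, y) (by simp [UnitTriangle.vertices])
    simp only [hexagonPoints, Set.mem_ofPred_eq] at h
    refine Or.inl ⟨(x, y), ⟨⟨?_, ?_⟩, ⟨?_, ?_⟩⟩, rfl⟩ <;> dsimp only <;> omega
  · have h := ht (x + 1, y + 1) (by simp [UnitTriangle.vertices])
    simp only [hexagonPoints, Set.mem_ofPred_eq] at h
    refine Or.inr ⟨(x, y), ⟨⟨?_, ?_⟩, ⟨?_, ?_⟩⟩, rfl⟩ <;> dsimp only <;> omega

/-- The shifted factorial `(α)_k = α (α + 1) ⋯ (α + k - 1)`, with `(α)_0 = 1`. -/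
def shiftedFactorial (α : ℚ) (k : ℕ) : ℚ :=
  ∏ i ∈ Finset.range k, (α + i)

/-- The product
`P_n(x, y) = ∏_{j=1}^n (j-1)! (x+y+2j)! (x-y+2j+1)_j (x+2y+3j+1)_{n-j} / ((x+n+2j)! (y+n-j)!)`
for integers `x`, `y` for which the numbers under the factorial signs are nonnegative. This is the
case for `n = b`, `x = a - 2b - 1`, `y = b + c + 1` whenever `b ≤ a`. -/
def tilingProduct (n : ℕ) (x y : ℤ) : ℚ :=
  ∏ j ∈ Finset.Icc 1 n,
    ((j - 1).factorial * (x + y + 2 * j).toNat.factorial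
        * shiftedFactorial (x - y + 2 * j + 1) j
        * shiftedFactorial (x + 2 * y + 3 * j + 1) (n - j) : ℚ)
      / ((x + n + 2 * j).toNat.factorial * (y + n - j).toNat.factorial)

/-!
Represent a horizontal unit segment by its left endpoint `(x, y)`. The lozenges of a tiling that
have no horizontal diagonal form `b` disjoint paths from the top of the region to its bottom side,
with steps `(0, -1)` and `(1, -1)`. Removing the northwestern staircase shifts the starting points
of the paths to `(-c + i, a + c - b + 1 + i)`, and removing the eastern staircase puts a wall on
the vertical line `2 x + y = 2 b`, which the paths must not touch.

The tilings are counted by a determinant of numbers of single paths. Instead of a sign-reversing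
involution on families of paths, `numLozengeTilings_pathRegion` uses induction on the region: sort
the tilings by the lozenge at one triangle of the top row (`numLozengeTilings_eq_sum`). This
either removes a lozenge with a horizontal diagonal or moves the start of one path down; a
determinant whose rows satisfy Pascal's recurrence changes in the same way. By the reflection
principle, the entries may be taken to be the differences of binomial coefficients
`wallPathCount`. The paths are counted up to points next to the wall below the bottom side, which
changes the matrix only by a unitriangular factor and makes each entry a product of factorials, up
to a linear factor that depends on the row alone.

With `x = a - 2 b - 1` and `y = b + c + 1`, there remains the determinant of the numbers `(x + y +
j + 2 l + 2)! / ((x + 2 j + l + 3)! (y - j + l)!)`. Its minors of consecutive rows and columns are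
of the same form with shifted `x` and `y`, so that it can be evaluated by Dodgson condensation
(`det_mul_det_interior`, `factorialMatrix_condensation`). That the product formula satisfies the
same recurrence (`factorialProduct_condensation`) comes down to the polynomial identity
`(n - 1) (y - x - 2 n - 1) (x + 2 y + n + 2)
  = (x + y + 3) (x + 3 n) y - (x + y + 2 n + 1) (x + n + 2) (y + n - 1)`.
Since `x` may be negative, reciprocals of factorials are extended by `0` to the negative integers;
the relation `1 / (m - 1)! = m / m!` then holds for all integers `m`.
-/

/-! ### Dodgson condensation -/

open Matrix in
/-- Jacobi's theorem on the minors of the adjugate matrix, before the cancellation of `M.det`: take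
determinants in the product of `M` with the matrix that has the first columns of the adjugate of
`M` and the last columns of the identity matrix. -/
theorem det_toBlocks₁₁_adjugate_mul_det {m n R : Type*} [Fintype m] [DecidableEq m] [Fintype n]
    [DecidableEq n] [CommRing R] (M : Matrix (m ⊕ n) (m ⊕ n) R) :
    M.det * M.adjugate.toBlocks₁₁.det = M.det ^ Fintype.card m * M.toBlocks₂₂.det := by
  have h := M.mul_adjugate
  rw [← fromBlocks_toBlocks M, ← fromBlocks_toBlocks (adjugate _), fromBlocks_multiply,
    ← fromBlocks_one, fromBlocks_smul, fromBlocks_inj, fromBlocks_toBlocks] at h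
  have key : M * fromBlocks M.adjugate.toBlocks₁₁ 0 M.adjugate.toBlocks₂₁ 1 =
      fromBlocks (M.det • 1) M.toBlocks₁₂ 0 M.toBlocks₂₂ := by
    nth_rw 1 [← fromBlocks_toBlocks M]
    rw [fromBlocks_multiply, h.1, h.2.2.1]
    simp
  have := congrArg det key
  rw [det_mul, det_fromBlocks_zero₁₂, det_fromBlocks_zero₂₁, det_one, mul_one, det_smul,
    det_one, mul_one] at this
  exact this

open Matrix in
/-- Jacobi's theorem on a minor of order two of the adjugate matrix. -/
theorem det_toBlocks₁₁_adjugate_fin_two {n R : Type*} [Fintype n]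
    [DecidableEq n] [CommRing R] (M : Matrix (Fin 2 ⊕ n) (Fin 2 ⊕ n) R) :
    M.adjugate.toBlocks₁₁.det = M.det * M.toBlocks₂₂.det := by
  -- It suffices to treat the generic matrix, whose determinant may be cancelled.
  let X := mvPolynomialX (Fin 2 ⊕ n) (Fin 2 ⊕ n) ℤ
  have hX : X.adjugate.toBlocks₁₁.det = X.det * X.toBlocks₂₂.det := by
    refine mul_left_cancel₀ (det_mvPolynomialX_ne_zero (Fin 2 ⊕ n) ℤ) ?_
    rw [det_toBlocks₁₁_adjugate_mul_det, Fintype.card_fin]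
    ring
  let φ : MvPolynomial ((Fin 2 ⊕ n) × (Fin 2 ⊕ n)) ℤ →+* R :=
    MvPolynomial.eval₂Hom (Int.castRingHom R) fun p => M p.1 p.2
  have hφ : φ.mapMatrix X = M := by
    ext i j
    simp [X, φ, mvPolynomialX]
  have h := congrArg φ hX
  rw [map_mul, RingHom.map_det, RingHom.map_det, RingHom.map_det, hφ] at h
  have h1 : φ.mapMatrix X.adjugate.toBlocks₁₁ = M.adjugate.toBlocks₁₁ := by
    rw [← hφ, ← RingHom.map_adjugate]
    rfl
  have h2 : φ.mapMatrix X.toBlocks₂₂ = M.toBlocks₂₂ := by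
    rw [← hφ]
    rfl
  rwa [h1, h2] at h

/-- Dodgson condensation (the Desnanot–Jacobi identity). -/
theorem det_mul_det_interior {R : Type*} [CommRing R] {n : ℕ}
    (M : Matrix (Fin (n + 2)) (Fin (n + 2)) R) :
    M.det * (M.submatrix (fun i : Fin n => i.castSucc.succ) fun j : Fin n => j.castSucc.succ).det =
      (M.submatrix Fin.castSucc Fin.castSucc).det * (M.submatrix Fin.succ Fin.succ).det -
        (M.submatrix Fin.castSucc Fin.succ).det * (M.submatrix Fin.succ Fin.castSucc).det := by
  -- Reorder the indices so that the first and the last one form the first block.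
  let f : Fin 2 ⊕ Fin n → Fin (n + 2) := Sum.elim ![0, Fin.last _] fun i => i.castSucc.succ
  have hf : f.Injective := by
    rintro (i | i) (j | j) h
    · fin_cases i <;> fin_cases j <;> simp_all [f, Fin.ext_iff]
    · fin_cases i
      · simp [f, Fin.ext_iff] at h
      · simp [f, Fin.ext_iff] at h
        omega
    · fin_cases j
      · simp [f, Fin.ext_iff] at h
      · simp [f, Fin.ext_iff] at h
        omega
    · simpa [f, Fin.ext_iff] using h
  have hb : f.Bijective := by
    rw [Fintype.bijective_iff_injective_and_card]
    exact ⟨hf, by simp [add_comm]⟩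
  let e := Equiv.ofBijective f hb
  have h := det_toBlocks₁₁_adjugate_fin_two (M.submatrix e e)
  rw [Matrix.det_submatrix_equiv_self, Matrix.adjugate_submatrix_equiv_self,
    Matrix.det_fin_two] at h
  have h22 : (M.submatrix e e).toBlocks₂₂ =
    M.submatrix (fun i : Fin n => i.castSucc.succ) fun j : Fin n => j.castSucc.succ := rfl
  have e0 : e (Sum.inl 0) = 0 := rfl
  have e1 : e (Sum.inl 1) = Fin.last _ := rfl
  rw [h22] at h
  rw [← h]
  simp only [Matrix.toBlocks₁₁, Matrix.of_apply, Matrix.submatrix_apply, e0, e1,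
    Matrix.adjugate_fin_succ_eq_det_submatrix, Fin.succAbove_zero, Fin.succAbove_last,
    Fin.val_zero, Fin.val_last]
  have hs : ((-1 : R) ^ (n + 1)) * (-1) ^ (n + 1) = 1 := by
    rw [← mul_pow]; simp
  simp only [add_zero, zero_add, pow_zero, one_mul]
  rw [Even.neg_one_pow ⟨n + 1, rfl⟩]
  linear_combination (-(M.submatrix Fin.castSucc Fin.succ).det *
    (M.submatrix Fin.succ Fin.castSucc).det) * hs

/-! ### Sorting lozenge tilings by one lozenge -/

open UnitTriangle

theorem numLozengeTilings_empty : numLozengeTilings ∅ = 1 := by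
  rw [numLozengeTilings, Set.ncard_eq_one]
  refine ⟨∅, Set.ext fun T => ⟨?_, ?_⟩⟩
  · rintro ⟨h1, -, h3⟩
    refine Set.eq_empty_of_forall_notMem fun L hL => ?_
    obtain ⟨s, t, -, rfl⟩ := h1 L hL
    have : s ∈ ⋃₀ T := ⟨_, hL, by simp⟩
    simp [h3] at this
  · rintro rfl
    exact ⟨by simp, by simp, by simp⟩

theorem UnitTriangle.Adjacent.symm {s t : UnitTriangle} (h : s.Adjacent t) : t.Adjacent s := by
  rwa [Adjacent, Finset.inter_comm]

theorem UnitTriangle.card_vertices (t : UnitTriangle) : t.vertices.card = 3 := by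
  cases t <;> simp [vertices, Finset.card_insert_of_notMem, Prod.ext_iff]

theorem UnitTriangle.Adjacent.ne {s t : UnitTriangle} (h : s.Adjacent t) : s ≠ t := by
  rintro rfl
  simp [Adjacent, card_vertices] at h

theorem IsLozenge.exists_eq_pair {L : Set UnitTriangle} (hL : IsLozenge L) {t : UnitTriangle}
    (ht : t ∈ L) : ∃ n, t.Adjacent n ∧ L = {t, n} := by
  obtain ⟨u, v, h, rfl⟩ := hL
  rcases ht with rfl | ht
  · exact ⟨v, h, rfl⟩
  · rw [Set.mem_singleton_iff] at ht
    subst ht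
    exact ⟨u, h.symm, Set.pair_comm _ _⟩

theorem IsLozengeTiling.insert {R : Set UnitTriangle} {t n : UnitTriangle} (ht : t ∈ R)
    (hn : n ∈ R) (h : t.Adjacent n) {T : Set (Set UnitTriangle)}
    (hT : IsLozengeTiling (R \ {t, n}) T) : IsLozengeTiling R (insert {t, n} T) := by
  obtain ⟨h1, h2, h3⟩ := hT
  refine ⟨?_, ?_, ?_⟩
  · rintro L (rfl | hL)
    exacts [⟨t, n, h, rfl⟩, h1 L hL]
  · refine h2.insert fun L hL _ => ?_
    have : L ⊆ R \ {t, n} := h3 ▸ Set.subset_sUnion_of_mem hL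
    exact (Set.disjoint_sdiff_left.mono_left this).symm
  · rw [Set.sUnion_insert, h3, Set.union_sdiff_cancel]
    rintro _ (rfl | rfl)
    exacts [ht, hn]

theorem IsLozengeTiling.diff {R : Set UnitTriangle} {T : Set (Set UnitTriangle)}
    (hT : IsLozengeTiling R T) {L : Set UnitTriangle} (hL : L ∈ T) :
    IsLozengeTiling (R \ L) (T \ {L}) := by
  obtain ⟨h1, h2, h3⟩ := hT
  refine ⟨fun K hK => h1 K hK.1, h2.subset Set.sdiff_subset, ?_⟩
  ext u
  constructor
  · rintro ⟨K, ⟨hK, hKL⟩, hu⟩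
    exact ⟨h3 ▸ ⟨K, hK, hu⟩, fun huL => Set.disjoint_left.1 (h2 hK hL hKL) hu huL⟩
  · rintro ⟨hu, huL⟩
    rw [← h3] at hu
    obtain ⟨K, hK, hu⟩ := hu
    exact ⟨K, ⟨hK, by rintro rfl; exact huL hu⟩, hu⟩

/-- The tilings of `R` are sorted by the lozenge that covers the triangle `t`. -/
theorem numLozengeTilings_eq_sum {R : Set UnitTriangle} (hR : R.Finite) {t : UnitTriangle}
    (ht : t ∈ R) {N : Finset UnitTriangle} (hN : ∀ n, n ∈ N ↔ t.Adjacent n ∧ n ∈ R) :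
    numLozengeTilings R = ∑ n ∈ N, numLozengeTilings (R \ {t, n}) := by
  have hfin (n : UnitTriangle) : {T | IsLozengeTiling (R \ {t, n}) T}.Finite :=
    finite_setOf_isLozengeTiling hR.sdiff
  have hset : {T | IsLozengeTiling R T} =
      ⋃ n ∈ N, (fun T => insert {t, n} T) '' {T | IsLozengeTiling (R \ {t, n}) T} := by
    ext T
    simp only [Set.mem_iUnion, Set.mem_image, Set.mem_ofPred_eq, exists_prop]
    constructor
    · intro hT
      have ht' := ht
      rw [← hT.2.2] at ht'
      obtain ⟨L, hL, htL⟩ := ht'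
      obtain ⟨n, hn, rfl⟩ := (hT.1 L hL).exists_eq_pair htL
      refine ⟨n, (hN n).2 ⟨hn, hT.2.2 ▸ ⟨_, hL, by simp⟩⟩, _, hT.diff hL, ?_⟩
      simp [Set.insert_eq_of_mem hL]
    · rintro ⟨n, hn, T, hT, rfl⟩
      exact hT.insert ht ((hN n).1 hn).2 ((hN n).1 hn).1
  have hnot {n n' : UnitTriangle} {T} (hT : IsLozengeTiling (R \ {t, n}) T) : {t, n'} ∉ T := by
    intro h
    have : t ∈ R \ {t, n} := hT.2.2 ▸ ⟨_, h, by simp⟩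
    exact this.2 (by simp)
  have hmem : ∀ n ∈ (N : Set UnitTriangle),
      ((fun T => insert {t, n} T) '' {T | IsLozengeTiling (R \ {t, n}) T}).Finite :=
    fun n _ => (hfin n).image _
  have hdisj : (N : Set UnitTriangle).PairwiseDisjoint
      fun n => (fun T => insert {t, n} T) '' {T | IsLozengeTiling (R \ {t, n}) T} := by
    intro n hn n' hn' hne
    refine Set.disjoint_left.2 ?_
    rintro _ ⟨T, hT, rfl⟩ ⟨T', hT', h⟩
    have h' : ({t, n} : Set UnitTriangle) ∈ insert {t, n'} T' := by
      dsimp only at h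
      rw [h]
      exact Set.mem_insert _ _
    rcases h' with h' | h'
    · have hn2 : n ∈ ({t, n'} : Set UnitTriangle) := h' ▸ by simp
      rcases hn2 with rfl | hn2
      · exact ((hN n).1 hn).1.ne rfl
      · exact hne hn2
    · exact hnot hT' h'
  have hsum := N.finite_toSet.ncard_biUnion hmem hdisj
  simp only [Finset.mem_coe] at hsum
  rw [numLozengeTilings, hset, hsum, finsum_mem_finset_eq_sum]
  refine Finset.sum_congr rfl fun n _ => Set.InjOn.ncard_image ?_
  intro T hT T' hT' h
  dsimp only at h
  rw [← Set.insert_sdiff_self_of_notMem (hnot hT (n' := n)), h,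
    Set.insert_sdiff_self_of_notMem (hnot hT' (n' := n))]

theorem UnitTriangle.up_adjacent_iff {x y : ℤ} {t : UnitTriangle} :
    (up x y).Adjacent t ↔ t = down x y ∨ t = down (x - 1) y ∨ t = down x (y - 1) := by
  rcases t with ⟨x', y'⟩ | ⟨x', y'⟩
  · simp only [Adjacent, vertices, ← Finset.filter_mem_eq_inter, Finset.filter_insert,
      Finset.filter_singleton, Finset.mem_insert, Finset.mem_singleton, Prod.mk.injEq]
    split_ifs <;> simp [Finset.card_insert_of_notMem, Prod.ext_iff] <;> omega
  · simp only [Adjacent, vertices, ← Finset.filter_mem_eq_inter, Finset.filter_insert,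
      Finset.filter_singleton, Finset.mem_insert, Finset.mem_singleton, Prod.mk.injEq]
    split_ifs <;> simp [Finset.card_insert_of_notMem, Prod.ext_iff] <;> omega

theorem UnitTriangle.down_adjacent_iff {x y : ℤ} {t : UnitTriangle} :
    (down x y).Adjacent t ↔ t = up x y ∨ t = up (x + 1) y ∨ t = up x (y + 1) := by
  rcases t with ⟨x', y'⟩ | ⟨x', y'⟩
  · have h : (down x y).Adjacent (up x' y') ↔ (up x' y').Adjacent (down x y) :=
      ⟨Adjacent.symm, Adjacent.symm⟩
    rw [h, up_adjacent_iff]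
    simp
    omega
  · simp only [Adjacent, vertices, ← Finset.filter_mem_eq_inter, Finset.filter_insert,
      Finset.filter_singleton, Finset.mem_insert, Finset.mem_singleton, Prod.mk.injEq]
    split_ifs <;> simp [Finset.card_insert_of_notMem, Prod.ext_iff] <;> omega

/-! ### Lozenge tilings and nonintersecting paths -/

/-- The region described by a set `V` of horizontal unit segments, the segment from `(x, y)` to
`(x + 1, y)` being represented by `(x, y)`, and a subset `Q` of `V`. It consists of the triangles
above the segments in `V` that are not in `Q`, and of the triangles below the segments of `V` at
positive height. In a tiling, the lozenges without a horizontal diagonal form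
paths that go down from the segments in `Q` to the segments at height `0`. -/
def pathRegion (V Q : Set (ℤ × ℤ)) : Set UnitTriangle :=
  {t | match t with
    | up x y => (x, y) ∈ V ∧ (x, y) ∉ Q
    | down x y => (x, y + 1) ∈ V ∧ 0 ≤ y}

theorem up_mem_pathRegion {V Q : Set (ℤ × ℤ)} {x y : ℤ} :
    up x y ∈ pathRegion V Q ↔ (x, y) ∈ V ∧ (x, y) ∉ Q := Iff.rfl

theorem down_mem_pathRegion {V Q : Set (ℤ × ℤ)} {x y : ℤ} :
    down x y ∈ pathRegion V Q ↔ (x, y + 1) ∈ V ∧ 0 ≤ y := Iff.rfl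

theorem pathRegion_finite {V : Set (ℤ × ℤ)} (hV : V.Finite) (Q : Set (ℤ × ℤ)) :
    (pathRegion V Q).Finite := by
  refine ((hV.image fun p => up p.1 p.2).union (hV.image fun p => down p.1 (p.2 - 1))).subset ?_
  rintro (⟨x, y⟩ | ⟨x, y⟩) h
  · exact Or.inl ⟨(x, y), h.1, rfl⟩
  · exact Or.inr ⟨(x, y + 1), h.1, by simp⟩

/-- A segment of maximal height at which no path starts is the diagonal of a lozenge. -/
theorem numLozengeTilings_pathRegion_erase {V : Finset (ℤ × ℤ)} {Q : Set (ℤ × ℤ)} {v : ℤ × ℤ}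
    (hv : v ∈ V) (hvQ : v ∉ Q) (hmax : ∀ p ∈ V, p.2 ≤ v.2) (hpos : 0 < v.2) :
    numLozengeTilings (pathRegion V Q) = numLozengeTilings (pathRegion (V.erase v) Q) := by
  obtain ⟨x, y⟩ := v
  have hN (n : UnitTriangle) : n ∈ ({down x (y - 1)} : Finset UnitTriangle) ↔
      (up x y).Adjacent n ∧ n ∈ pathRegion V Q := by
    rw [up_adjacent_iff, Finset.mem_singleton]
    constructor
    · rintro rfl
      refine ⟨by simp, ?_⟩
      rw [down_mem_pathRegion, sub_add_cancel]
      dsimp only at hpos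
      exact ⟨hv, by omega⟩
    · rintro ⟨rfl | rfl | rfl, h⟩
      · have := hmax _ h.1
        simp at this
      · have := hmax _ h.1
        simp at this
      · rfl
  rw [numLozengeTilings_eq_sum (pathRegion_finite V.finite_toSet Q) (t := up x y) ⟨hv, hvQ⟩ hN,
    Finset.sum_singleton]
  congr 1
  ext (⟨x', y'⟩ | ⟨x', y'⟩)
  · simp [up_mem_pathRegion]
    tauto
  · simp [down_mem_pathRegion, eq_sub_iff_add_eq]
    tauto

/-- The path that starts at a segment `v` of maximal height goes down to one of the two adjacent
segments `w` of the next row. -/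
theorem numLozengeTilings_pathRegion_step {n : ℕ} {V : Finset (ℤ × ℤ)} {q : Fin n → ℤ × ℤ}
    {k : Fin n} (hv : q k ∈ V) (hpos : 0 < (q k).2) :
    numLozengeTilings (pathRegion V (Set.range q)) =
      ∑ w ∈ ({((q k).1, (q k).2 - 1), ((q k).1 + 1, (q k).2 - 1)} : Finset (ℤ × ℤ)) with
          w ∈ V ∧ w ∉ Set.range q,
        numLozengeTilings (pathRegion (V.erase (q k)) (Set.range (Function.update q k w))) := by
  classical
  let t := down (q k).1 ((q k).2 - 1)
  let N := ({((q k).1, (q k).2 - 1), ((q k).1 + 1, (q k).2 - 1)} : Finset (ℤ × ℤ)).filter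
    fun w => w ∈ V ∧ w ∉ Set.range q
  have hinj : Function.Injective fun w : ℤ × ℤ => up w.1 w.2 := by
    rintro ⟨x, y⟩ ⟨x', y'⟩ h
    simpa using h
  have ht : t ∈ pathRegion V (Set.range q) := by
    simp only [t, down_mem_pathRegion, sub_add_cancel]
    exact ⟨hv, by omega⟩
  have hN (n : UnitTriangle) : n ∈ N.image (fun w => up w.1 w.2) ↔
      t.Adjacent n ∧ n ∈ pathRegion V (Set.range q) := by
    rw [down_adjacent_iff]
    simp only [N, Finset.mem_image, Finset.mem_filter, Finset.mem_insert, Finset.mem_singleton,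
      sub_add_cancel]
    constructor
    · rintro ⟨w, ⟨rfl | rfl, hw⟩, rfl⟩
      exacts [⟨by simp, hw⟩, ⟨by simp, hw⟩]
    · rintro ⟨rfl | rfl | rfl, h⟩
      · exact ⟨_, ⟨Or.inl rfl, h⟩, rfl⟩
      · exact ⟨_, ⟨Or.inr rfl, h⟩, rfl⟩
      · exact (h.2 ⟨k, rfl⟩).elim
  rw [numLozengeTilings_eq_sum (pathRegion_finite V.finite_toSet _) ht hN,
    Finset.sum_image fun _ _ _ _ h => hinj h]
  refine Finset.sum_congr rfl fun w hw => ?_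
  congr 1
  have hrange (p : ℤ × ℤ) (hp : p ≠ q k) : p ∈ Set.range (Function.update q k w) ↔
      p = w ∨ p ∈ Set.range q := by
    constructor
    · rintro ⟨i, rfl⟩
      rcases eq_or_ne i k with rfl | hi
      · simp
      · simp [hi]
    · rintro (rfl | ⟨i, rfl⟩)
      · exact ⟨k, by simp⟩
      · exact ⟨i, by rw [Function.update_of_ne]; rintro rfl; exact hp rfl⟩
  ext (⟨x', y'⟩ | ⟨x', y'⟩)
  · by_cases hk : (x', y') = q k
    · simp [up_mem_pathRegion, hk, t]
    · have hw' : w = (x', y') ↔ x' = w.1 ∧ y' = w.2 := by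
        rw [eq_comm, Prod.ext_iff]
      simp only [Set.mem_sdiff, up_mem_pathRegion, hrange _ hk, Finset.coe_erase, t,
        Prod.ext_iff (y := w)]
      simp
      tauto
  · have : x' = (q k).1 ∧ y' = (q k).2 - 1 ↔ (x', y' + 1) = q k := by
      rw [Prod.ext_iff, eq_sub_iff_add_eq]
    simp [down_mem_pathRegion, t, this]
    tauto

theorem Fin.eq_id_of_strictMono {n : ℕ} {f : Fin n → Fin n} (hf : StrictMono f) : f = id :=
  funext fun _ => le_antisymm hf.apply_le hf.le_apply

/-- A determinant formula for the tilings of a region described by paths. The function `G` assigns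
to a segment a vector that plays the role of the numbers of paths from this segment to `n` fixed
targets. Only the recurrence, the vanishing outside of `V` and the normalization at height `0`
matter, so there is a choice of targets. In the induction on `V`, the step of a path expands one
row of the determinant into a sum of two rows, and two paths that run into each other give two equal
rows. -/
theorem numLozengeTilings_pathRegion {n : ℕ} {G : ℤ × ℤ → Fin n → ℤ}
    (hdet : (Matrix.of fun i : Fin n => G ((i : ℤ), 0)).det = 1) {V : Finset (ℤ × ℤ)}
    (hV : ∀ p ∈ V, 0 ≤ p.2) (hV0 : ∀ x, (x, 0) ∈ V ↔ 0 ≤ x ∧ x < n)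
    (hG : ∀ p ∈ V, 0 < p.2 → G p = G (p.1, p.2 - 1) + G (p.1 + 1, p.2 - 1))
    (hout : ∀ p ∈ V, 0 < p.2 → ∀ w, w = (p.1, p.2 - 1) ∨ w = (p.1 + 1, p.2 - 1) → w ∉ V → G w = 0)
    {q : Fin n → ℤ × ℤ} (hq : StrictMono q) (hqV : ∀ i, q i ∈ V) :
    (numLozengeTilings (pathRegion V (Set.range q)) : ℤ) =
      (Matrix.of fun i => G (q i)).det := by
  classical
  induction hm : V.card using Nat.strong_induction_on generalizing V q with
  | _ m ih =>
  have hlt {v} (hv : v ∈ V) : (V.erase v).card < m := hm ▸ Finset.card_erase_lt_of_mem hv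
  have hV' (v : ℤ × ℤ) : ∀ p ∈ V.erase v, 0 ≤ p.2 := fun p hp => hV p (Finset.mem_of_mem_erase hp)
  have hV0' {v : ℤ × ℤ} (hv : 0 < v.2) : ∀ x, (x, 0) ∈ V.erase v ↔ 0 ≤ x ∧ x < n := by
    intro x
    rw [Finset.mem_erase, hV0, and_iff_right]
    rintro rfl
    exact lt_irrefl _ hv
  have hG' (v : ℤ × ℤ) : ∀ p ∈ V.erase v, 0 < p.2 →
      G p = G (p.1, p.2 - 1) + G (p.1 + 1, p.2 - 1) :=
    fun p hp => hG p (Finset.mem_of_mem_erase hp)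
  have hout' {v : ℤ × ℤ} (hmax : ∀ p ∈ V, p.2 ≤ v.2) : ∀ p ∈ V.erase v, 0 < p.2 →
      ∀ w, w = (p.1, p.2 - 1) ∨ w = (p.1 + 1, p.2 - 1) → w ∉ V.erase v → G w = 0 := by
    intro p hp hp0 w hw hwV
    have hpV := Finset.mem_of_mem_erase hp
    refine hout p hpV hp0 w hw fun h => hwV (Finset.mem_erase.2 ⟨?_, h⟩)
    rintro rfl
    have := hmax p hpV
    rcases hw with rfl | rfl <;> simp at this
  by_cases h0 : ∀ p ∈ V, p.2 ≤ 0
  · -- All segments have height `0`, and a path starts (and ends) at each of them.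
    have hy (i : Fin n) : (q i).2 = 0 := le_antisymm (h0 _ (hqV i)) (hV _ (hqV i))
    have hx (i : Fin n) : 0 ≤ (q i).1 ∧ (q i).1 < n := by
      rw [← hV0, ← hy i]
      exact hqV i
    have hf : StrictMono fun i : Fin n => (⟨(q i).1.toNat, by have := hx i; omega⟩ : Fin n) := by
      intro i j hij
      have h1 := hq hij
      have h2 : (q i).1 < (q j).1 := by
        rcases Prod.lt_iff.1 h1 with h | h
        · exact h.1
        · rw [hy, hy] at h
          exact absurd h.2 (lt_irrefl _)
      have := hx i
      simp only [Fin.mk_lt_mk]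
      omega
    have hid (i : Fin n) : q i = ((i : ℤ), 0) := by
      have h1 := congrArg Fin.val (congrFun (Fin.eq_id_of_strictMono hf) i)
      have := hx i
      simp only [id] at h1
      refine Prod.ext ?_ (hy i)
      dsimp only
      omega
    have hempty : pathRegion V (Set.range q) = ∅ := by
      refine Set.eq_empty_of_forall_notMem ?_
      rintro (⟨x, y⟩ | ⟨x, y⟩) ⟨h1, h2⟩
      · obtain rfl : y = 0 := le_antisymm (h0 _ h1) (hV _ h1)
        have h3 := (hV0 x).1 h1
        refine h2 ⟨⟨x.toNat, by omega⟩, ?_⟩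
        rw [hid]
        simpa using h3.1
      · have := h0 _ h1
        dsimp only at this
        omega
    simp only [hempty, numLozengeTilings_empty, hid, hdet, Nat.cast_one]
  push Not at h0
  obtain ⟨u, hu, hu0⟩ := h0
  obtain ⟨v, hv, hmax⟩ := V.exists_max_image Prod.snd ⟨u, hu⟩
  have hv0 : 0 < v.2 := hu0.trans_le (hmax u hu)
  by_cases hvq : ∃ i, (q i).2 = v.2
  · -- The leftmost path that starts in the top row makes a step; this keeps the starting points
    -- in increasing order.
    obtain ⟨k, hk, hkmin⟩ := (Finset.univ.filter fun i => (q i).2 = v.2).exists_min_image id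
      (by obtain ⟨i, hi⟩ := hvq; exact ⟨i, by simpa using hi⟩)
    replace hk : (q k).2 = v.2 := by simpa using hk
    replace hkmin : ∀ i, (q i).2 = v.2 → k ≤ i := by simpa using hkmin
    have hk0 : 0 < (q k).2 := hk ▸ hv0
    rw [← hk] at hmax
    set w₁ : ℤ × ℤ := ((q k).1, (q k).2 - 1) with hw₁
    set w₂ : ℤ × ℤ := ((q k).1 + 1, (q k).2 - 1) with hw₂
    have hne : w₁ ≠ w₂ := by simp [hw₁, hw₂]
    set M := Matrix.of fun i => G (q i) with hM
    have hstep (w) (hw : w = w₁ ∨ w = w₂) : (M.updateRow k (G w)).det =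
        if w ∈ V ∧ w ∉ Set.range q then
          (numLozengeTilings (pathRegion (V.erase (q k)) (Set.range (Function.update q k w))) : ℤ)
        else 0 := by
      have hwy : w.2 = (q k).2 - 1 := by rcases hw with rfl | rfl <;> rfl
      have hwx : (q k).1 ≤ w.1 ∧ w.1 ≤ (q k).1 + 1 := by
        rcases hw with rfl | rfl
        exacts [⟨le_rfl, Int.le_add_one le_rfl⟩, ⟨Int.le_add_one le_rfl, le_rfl⟩]
      split_ifs with h
      · have hmono : StrictMono (Function.update q k w) := by
          intro i j hij
          rcases eq_or_ne i k with rfl | hi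
          · rw [Function.update_self, Function.update_of_ne hij.ne']
            have h1 := hq hij
            have h2 : (q j).2 = (q i).2 := le_antisymm (hmax _ (hqV j)) h1.le.2
            have h3 : (q i).1 < (q j).1 := by
              rcases Prod.lt_iff.1 h1 with h | h
              · exact h.1
              · exact absurd h.2 (h2 ▸ lt_irrefl _)
            refine Prod.lt_iff.2 (Or.inr ⟨?_, by omega⟩)
            omega
          · rw [Function.update_of_ne hi]
            rcases eq_or_ne j k with rfl | hj
            · rw [Function.update_self]
              refine lt_of_le_of_ne ?_ fun h' => h.2 ⟨i, h'⟩
              have h1 := (hq hij).le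
              have h2 : (q i).2 ≠ (q j).2 := fun h' => absurd (hkmin i (h'.trans hk)) (not_le.2 hij)
              have h3 := h1.2
              have h4 := h1.1
              exact ⟨by omega, by omega⟩
            · rw [Function.update_of_ne hj]
              exact hq hij
        have hmem (i) : Function.update q k w i ∈ V.erase (q k) := by
          rw [Finset.mem_erase]
          rcases eq_or_ne i k with rfl | hi
          · rw [Function.update_self]
            exact ⟨fun h' => h.2 ⟨i, h'.symm⟩, h.1⟩
          · rw [Function.update_of_ne hi]
            exact ⟨fun h' => hi (hq.injective h'), hqV i⟩
        rw [ih _ (hlt (hqV k)) (hV' _) (hV0' hk0) (hG' _) (hout' hmax) hmono hmem rfl]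
        congr 1
        ext i j
        rcases eq_or_ne i k with rfl | hi
        · simp
        · simp [hi, hM]
      · rw [not_and_or, not_not] at h
        rcases h with h | ⟨i, rfl⟩
        · rw [hout _ (hqV k) hk0 w hw h]
          exact Matrix.det_eq_zero_of_row_eq_zero k (by simp)
        · have hik : i ≠ k := by
            rintro rfl
            omega
          refine Matrix.det_zero_of_row_eq hik.symm ?_
          ext j
          simp [hik, hM]
    have hMk : M.det = (M.updateRow k (G w₁)).det + (M.updateRow k (G w₂)).det := by
      rw [← Matrix.det_updateRow_add, ← hG _ (hqV k) hk0]
      congr 1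
      ext i j
      rcases eq_or_ne i k with rfl | hi
      · simp [hM]
      · simp [hi]
    rw [numLozengeTilings_pathRegion_step (hqV k) hk0, Finset.sum_filter,
      Finset.sum_pair hne, hMk, hstep _ (Or.inl rfl), hstep _ (Or.inr rfl)]
    push_cast
    rfl
  · -- The maximal segment `v` is the diagonal of a lozenge.
    have hvq' : v ∉ Set.range q := by
      rintro ⟨i, rfl⟩
      exact hvq ⟨i, rfl⟩
    rw [numLozengeTilings_pathRegion_erase hv hvq' hmax hv0]
    refine ih _ (hlt hv) (hV' _) (hV0' hv0) (hG' _) (hout' hmax) hq (fun i => ?_) rfl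
    exact Finset.mem_erase.2 ⟨fun h => hvq' ⟨i, h⟩, hqV i⟩

/-! ### Evaluation of the determinant of factorials -/

/-- The reciprocal `1 / m!` of the factorial of an integer, which is `0` for `m < 0`. -/
def invFactorial (m : ℤ) : ℚ :=
  if 0 ≤ m then ((m.toNat).factorial : ℚ)⁻¹ else 0

theorem invFactorial_natCast (m : ℕ) : invFactorial m = (m.factorial : ℚ)⁻¹ := by
  simp [invFactorial]

theorem invFactorial_of_neg {m : ℤ} (hm : m < 0) : invFactorial m = 0 :=
  if_neg (not_le.2 hm)

theorem invFactorial_ne_zero {m : ℤ} (hm : 0 ≤ m) : invFactorial m ≠ 0 := by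
  rw [invFactorial, if_pos hm]
  exact inv_ne_zero (Nat.cast_ne_zero.2 (Nat.factorial_ne_zero _))

theorem invFactorial_sub_one (m : ℤ) : invFactorial (m - 1) = m * invFactorial m := by
  rcases lt_trichotomy m 0 with hm | rfl | hm
  · rw [invFactorial_of_neg hm, invFactorial_of_neg (by omega), mul_zero]
  · rw [invFactorial_of_neg (by omega), Int.cast_zero, zero_mul]
  · obtain ⟨k, rfl⟩ : ∃ k : ℕ, m = ((k + 1 : ℕ) : ℤ) := ⟨(m - 1).toNat, by omega⟩
    rw [invFactorial_natCast, Nat.factorial_succ, Nat.cast_succ, add_sub_cancel_right,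
      invFactorial_natCast]
    have : (k.factorial : ℚ) ≠ 0 := Nat.cast_ne_zero.2 (Nat.factorial_ne_zero _)
    push_cast
    field_simp

/-- The entries `(x + y + j + 2 l + 2)! / ((x + 2 j + l + 3)! (y - j + l)!)`, with `s = x + y`. -/
def factorialEntry (s : ℕ) (y : ℤ) (j l : ℕ) : ℚ :=
  (s + j + 2 * l + 2).factorial * invFactorial (s - y + 2 * j + l + 3) * invFactorial (y - j + l)

theorem factorialEntry_succ_left (s : ℕ) (y : ℤ) (j l : ℕ) :
    factorialEntry s y (j + 1) l = factorialEntry (s + 1) (y - 1) j l := by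
  unfold factorialEntry
  congr 2
  · congr 3
    ring
  · congr 1
    push_cast
    ring
  · push_cast
    ring

theorem factorialEntry_succ_right (s : ℕ) (y : ℤ) (j l : ℕ) :
    factorialEntry s y j (l + 1) = factorialEntry (s + 2) (y + 1) j l := by
  unfold factorialEntry
  congr 2
  · congr 3
    ring
  · congr 1
    push_cast
    ring
  · push_cast
    ring

/-- The matrix of the entries `factorialEntry s y j l` for `0 ≤ j, l < n`, with the columns in
decreasing order of `l`. -/
def factorialMatrix (n s : ℕ) (y : ℤ) : Matrix (Fin n) (Fin n) ℚ :=
  Matrix.of fun j l => factorialEntry s y j l.rev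

theorem factorialMatrix_condensation (n s : ℕ) (y : ℤ) :
    (factorialMatrix (n + 2) s y).det * (factorialMatrix n (s + 3) y).det =
      (factorialMatrix (n + 1) (s + 2) (y + 1)).det * (factorialMatrix (n + 1) (s + 1) (y - 1)).det
        - (factorialMatrix (n + 1) s y).det * (factorialMatrix (n + 1) (s + 3) y).det := by
  have h := det_mul_det_interior (factorialMatrix (n + 2) s y)
  have h1 : (factorialMatrix (n + 2) s y).submatrix Fin.castSucc Fin.castSucc =
      factorialMatrix (n + 1) (s + 2) (y + 1) := by
    ext j l
    simp only [factorialMatrix, Matrix.submatrix_apply, Matrix.of_apply, Fin.rev_castSucc,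
      Fin.val_succ, Fin.val_castSucc, factorialEntry_succ_right]
  have h2 : (factorialMatrix (n + 2) s y).submatrix Fin.succ Fin.succ =
      factorialMatrix (n + 1) (s + 1) (y - 1) := by
    ext j l
    simp only [factorialMatrix, Matrix.submatrix_apply, Matrix.of_apply, Fin.rev_succ,
      Fin.val_succ, Fin.val_castSucc, factorialEntry_succ_left]
  have h3 : (factorialMatrix (n + 2) s y).submatrix Fin.castSucc Fin.succ =
      factorialMatrix (n + 1) s y := by
    ext j l
    simp only [factorialMatrix, Matrix.submatrix_apply, Matrix.of_apply, Fin.rev_succ,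
      Fin.val_castSucc]
  have h4 : (factorialMatrix (n + 2) s y).submatrix Fin.succ Fin.castSucc =
      factorialMatrix (n + 1) (s + 3) y := by
    ext j l
    simp only [factorialMatrix, Matrix.submatrix_apply, Matrix.of_apply, Fin.rev_castSucc,
      Fin.val_succ, factorialEntry_succ_left, factorialEntry_succ_right, sub_add_cancel]
  have h5 : (factorialMatrix (n + 2) s y).submatrix (fun i : Fin n => i.castSucc.succ)
      (fun j : Fin n => j.castSucc.succ) = factorialMatrix n (s + 3) y := by
    ext j l
    simp only [factorialMatrix, Matrix.submatrix_apply, Matrix.of_apply, Fin.rev_castSucc,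
      Fin.rev_succ, Fin.val_succ, Fin.val_castSucc, factorialEntry_succ_left,
      factorialEntry_succ_right, sub_add_cancel]
  rwa [h1, h2, h3, h4, h5] at h

open Finset in
/-- Comparison of the two sides of the condensation formula for one factor of the product; each of
the lemmas `*_mul`, `*_mul_outer` and `*_mul_inner` below does this for another factor. -/
theorem prod_factorial_mul (n : ℕ) :
    (∏ i ∈ range (n + 2), (i.factorial : ℚ)) * ∏ i ∈ range n, (i.factorial : ℚ) =
      (n + 1) * ((∏ i ∈ range (n + 1), (i.factorial : ℚ)) *
        ∏ i ∈ range (n + 1), (i.factorial : ℚ)) := by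
  rw [prod_range_succ _ (n + 1), prod_range_succ _ n, Nat.factorial_succ]
  push_cast
  ring

/-- `∏_{j=1}^n (s + 2j)!` -/
def numFactor (n s : ℕ) : ℚ := ∏ i ∈ Finset.range n, ((s + 2 * i + 2).factorial : ℚ)

theorem numFactor_succ (n s : ℕ) :
    numFactor (n + 1) s = numFactor n s * (s + 2 * n + 2).factorial :=
  Finset.prod_range_succ _ _

theorem numFactor_succ' (n s : ℕ) :
    numFactor (n + 1) s = numFactor n (s + 2) * (s + 2).factorial := by
  rw [numFactor, Finset.prod_range_succ', numFactor]
  congr 1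
  refine Finset.prod_congr rfl fun i _ => ?_
  congr 2
  ring

theorem numFactor_mul_outer (n s : ℕ) :
    numFactor (n + 1) s * numFactor (n + 1) (s + 3) =
      (s + 2 * n + 5) * (numFactor (n + 2) s * numFactor n (s + 3)) := by
  rw [numFactor_succ (n + 1), numFactor_succ n (s + 3)]
  have : s + 3 + 2 * n + 2 = (s + 2 * (n + 1) + 2) + 1 := by ring
  rw [this, Nat.factorial_succ]
  push_cast
  ring

theorem numFactor_mul_inner (n s : ℕ) :
    numFactor (n + 1) (s + 2) * numFactor (n + 1) (s + 1) =
      (s + 3) * (numFactor (n + 2) s * numFactor n (s + 3)) := by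
  rw [numFactor_succ' (n + 1) s, numFactor_succ' n (s + 1)]
  have : s + 1 + 2 = (s + 2) + 1 := by ring
  rw [this, Nat.factorial_succ]
  push_cast
  ring

/-- `∏_{j=1}^n (d - 2j - 1) (d - 2j - 2) ⋯ (d - 3j + 1)` -/
def diffFactor (n : ℕ) (d : ℚ) : ℚ :=
  ∏ i ∈ Finset.range n, ∏ t ∈ Finset.range i, (d - 2 * i - 3 - t)

theorem diffFactor_mul (n : ℕ) (d : ℚ) :
    diffFactor (n + 2) d * diffFactor n (d - 3) =
      (d - 2 * n - 5) * (diffFactor (n + 1) d * diffFactor (n + 1) (d - 3)) := by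
  have h1 : diffFactor (n + 2) d =
      diffFactor (n + 1) d * ∏ t ∈ Finset.range (n + 1), (d - 2 * (n + 1 : ℕ) - 3 - t) :=
    Finset.prod_range_succ _ _
  have h2 : diffFactor (n + 1) (d - 3) =
      diffFactor n (d - 3) * ∏ t ∈ Finset.range n, (d - 3 - 2 * n - 3 - t) :=
    Finset.prod_range_succ _ _
  have h3 : ∏ t ∈ Finset.range n, (d - 2 * (n + 1 : ℕ) - 3 - (t + 1 : ℕ)) =
      ∏ t ∈ Finset.range n, (d - 3 - 2 * n - 3 - t) :=
    Finset.prod_congr rfl fun t _ => by push_cast; ring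
  rw [h1, h2, Finset.prod_range_succ', h3]
  push_cast
  ring

/-- `∏_{j=1}^n (w + 3j + 1)_{n-j}` -/
def sumFactor (n : ℕ) (w : ℚ) : ℚ :=
  ∏ i ∈ Finset.range n, ∏ t ∈ Finset.range (n - 1 - i), (w + 3 * i + 4 + t)

theorem sumFactor_succ (n : ℕ) (w : ℚ) :
    sumFactor (n + 1) w = sumFactor n w * ∏ i ∈ Finset.range n, (w + n + 3 + 2 * i) := by
  rw [sumFactor, Finset.prod_range_succ, sumFactor]
  simp only [Nat.add_sub_cancel, Nat.sub_self, Finset.range_zero, Finset.prod_empty, mul_one]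
  rw [← Finset.prod_mul_distrib]
  refine Finset.prod_congr rfl fun i hi => ?_
  have hi' := Finset.mem_range.1 hi
  obtain ⟨k, rfl⟩ : ∃ k, n = i + k + 1 := ⟨n - i - 1, by omega⟩
  rw [show i + k + 1 - i = k + 1 by omega, show i + k + 1 - 1 - i = k by omega,
    Finset.prod_range_succ]
  push_cast
  ring

theorem sumFactor_mul (n : ℕ) (w : ℚ) :
    sumFactor (n + 2) w * sumFactor n (w + 3) =
      (w + n + 4) * (sumFactor (n + 1) w * sumFactor (n + 1) (w + 3)) := by
  have h : ∏ t ∈ Finset.range n, (w + (n + 1 : ℕ) + 3 + 2 * (t + 1 : ℕ)) =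
      ∏ t ∈ Finset.range n, (w + 3 + n + 3 + 2 * t) :=
    Finset.prod_congr rfl fun t _ => by push_cast; ring
  rw [sumFactor_succ (n + 1), sumFactor_succ n (w + 3), Finset.prod_range_succ', h]
  push_cast
  ring

/-- `∏_{j=1}^n 1 / (x + n + 2j)!` -/
def denFactor (n : ℕ) (x : ℤ) : ℚ := ∏ i ∈ Finset.range n, invFactorial (x + n + 2 * i + 2)

theorem denFactor_succ (n : ℕ) (x : ℤ) :
    denFactor (n + 1) x = denFactor n (x + 1) * invFactorial (x + 3 * n + 3) := by
  rw [denFactor, Finset.prod_range_succ, denFactor]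
  congr 1
  · refine Finset.prod_congr rfl fun i _ => ?_
    congr 1
    push_cast
    ring
  · congr 1
    push_cast
    ring

theorem denFactor_succ' (n : ℕ) (x : ℤ) :
    denFactor (n + 1) x = denFactor n (x + 3) * invFactorial (x + n + 3) := by
  rw [denFactor, Finset.prod_range_succ', denFactor]
  congr 1
  · refine Finset.prod_congr rfl fun i _ => ?_
    congr 1
    push_cast
    ring
  · congr 1
    push_cast
    ring

theorem denFactor_mul_outer (n : ℕ) (x : ℤ) :
    denFactor (n + 1) x * denFactor (n + 1) (x + 3) =
      (x + n + 4) * (denFactor (n + 2) x * denFactor n (x + 3)) := by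
  have h := invFactorial_sub_one (x + n + 4)
  rw [denFactor_succ' (n + 1) x, denFactor_succ' n x, show x + n + 3 = x + n + 4 - 1 by ring, h,
    show x + (n + 1 : ℕ) + 3 = x + n + 4 by push_cast; ring]
  push_cast
  ring

theorem denFactor_mul_inner (n : ℕ) (x : ℤ) :
    denFactor (n + 1) (x + 1) * denFactor (n + 1) (x + 2) =
      (x + 3 * n + 6) * (denFactor (n + 2) x * denFactor n (x + 3)) := by
  have h := invFactorial_sub_one (x + 3 * n + 6)
  rw [denFactor_succ (n + 1) x, denFactor_succ n (x + 2),
    show x + 2 + 3 * n + 3 = x + 3 * n + 6 - 1 by ring, h,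
    show x + 3 * (n + 1 : ℕ) + 3 = x + 3 * n + 6 by push_cast; ring,
    show x + 2 + 1 = x + 3 by ring]
  push_cast
  ring

/-- `∏_{j=1}^n 1 / (y + n - j)!` -/
def denFactor₂ (n : ℕ) (y : ℤ) : ℚ := ∏ i ∈ Finset.range n, invFactorial (y + i)

theorem denFactor₂_succ (n : ℕ) (y : ℤ) :
    denFactor₂ (n + 1) y = denFactor₂ n y * invFactorial (y + n) :=
  Finset.prod_range_succ _ _

theorem denFactor₂_succ' (n : ℕ) (y : ℤ) :
    denFactor₂ (n + 1) y = denFactor₂ n (y + 1) * invFactorial y := by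
  rw [denFactor₂, Finset.prod_range_succ', denFactor₂]
  congr 1
  · refine Finset.prod_congr rfl fun i _ => ?_
    congr 1
    push_cast
    ring
  · simp

theorem denFactor₂_mul_outer (n : ℕ) (y : ℤ) :
    denFactor₂ (n + 1) y * denFactor₂ (n + 1) y =
      (y + n + 1) * (denFactor₂ (n + 2) y * denFactor₂ n y) := by
  have h := invFactorial_sub_one (y + n + 1)
  rw [add_sub_cancel_right] at h
  rw [denFactor₂_succ (n + 1) y, show y + (n + 1 : ℕ) = y + n + 1 by push_cast; ring]
  nth_rw 2 [denFactor₂_succ n y]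
  rw [h]
  push_cast
  ring

theorem denFactor₂_mul_inner (n : ℕ) (y : ℤ) :
    denFactor₂ (n + 1) (y + 1) * denFactor₂ (n + 1) (y - 1) =
      y * (denFactor₂ (n + 2) y * denFactor₂ n y) := by
  rw [denFactor₂_succ' (n + 1) y, denFactor₂_succ' n (y - 1), invFactorial_sub_one,
    sub_add_cancel]
  ring

/-- The value of the determinant of `factorialMatrix n s y`; here `y - x = 2 y - s` and
`x + 2 y = s + y`. -/
def factorialProduct (n s : ℕ) (y : ℤ) : ℚ :=
  (∏ i ∈ Finset.range n, (i.factorial : ℚ)) * numFactor n s * diffFactor n (2 * y - s) *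
    sumFactor n (s + y) * denFactor n (s - y) * denFactor₂ n y

theorem factorialProduct_condensation (n s : ℕ) (y : ℤ) :
    factorialProduct (n + 2) s y * factorialProduct n (s + 3) y =
      factorialProduct (n + 1) (s + 2) (y + 1) * factorialProduct (n + 1) (s + 1) (y - 1)
        - factorialProduct (n + 1) s y * factorialProduct (n + 1) (s + 3) y := by
  have hA := prod_factorial_mul n
  have hB := numFactor_mul_outer n s
  have hB' := numFactor_mul_inner n s
  have hC := diffFactor_mul n (2 * y - s)
  have hD := sumFactor_mul n (s + y)
  have hE := denFactor_mul_outer n (s - y)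
  have hE' := denFactor_mul_inner n (s - y)
  have hH := denFactor₂_mul_outer n y
  have hH' := denFactor₂_mul_inner n y
  unfold factorialProduct
  rw [show (2 * y - (s + 3 : ℕ) : ℚ) = 2 * y - s - 3 by push_cast; ring,
    show (2 * (y + 1 : ℤ) - (s + 2 : ℕ) : ℚ) = 2 * y - s by push_cast; ring,
    show (2 * (y - 1 : ℤ) - (s + 1 : ℕ) : ℚ) = 2 * y - s - 3 by push_cast; ring,
    show ((s + 3 : ℕ) + y : ℚ) = s + y + 3 by push_cast; ring,
    show ((s + 2 : ℕ) + (y + 1 : ℤ) : ℚ) = s + y + 3 by push_cast; ring,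
    show ((s + 1 : ℕ) + (y - 1 : ℤ) : ℚ) = s + y by push_cast; ring,
    show ((s + 3 : ℕ) - y : ℤ) = s - y + 3 by push_cast; ring,
    show ((s + 2 : ℕ) - (y + 1) : ℤ) = s - y + 1 by push_cast; ring,
    show ((s + 1 : ℕ) - (y - 1) : ℤ) = s - y + 2 by push_cast; ring]
  push_cast at hE hE'
  generalize (∏ i ∈ Finset.range (n + 2), (i.factorial : ℚ)) = A2 at *
  generalize (∏ i ∈ Finset.range (n + 1), (i.factorial : ℚ)) = A1 at *
  generalize (∏ i ∈ Finset.range n, (i.factorial : ℚ)) = A0 at *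
  generalize diffFactor (n + 2) (2 * y - s) = C2 at *
  generalize diffFactor n (2 * y - s - 3) = C0 at *
  generalize diffFactor (n + 1) (2 * y - s) = C1 at *
  generalize diffFactor (n + 1) (2 * y - s - 3) = C1' at *
  generalize sumFactor (n + 2) (s + y) = D2 at *
  generalize sumFactor n (s + y + 3) = D0 at *
  generalize sumFactor (n + 1) (s + y) = D1 at *
  generalize sumFactor (n + 1) (s + y + 3) = D1' at *
  generalize numFactor (n + 2) s = B2 at *
  generalize numFactor n (s + 3) = B0 at *
  generalize denFactor (n + 2) (s - y) = E2 at *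
  generalize denFactor n (s - y + 3) = E0 at *
  generalize denFactor₂ (n + 2) y = H2 at *
  generalize denFactor₂ n y = H0 at *
  -- Up to common factors, this is a polynomial identity.
  calc _ = (A2 * A0) * (B2 * B0) * (C2 * C0) * (D2 * D0) * (E2 * E0) * (H2 * H0) := by ring
    _ = (A1 * A1) * ((s + 3) * (B2 * B0)) * (C1 * C1') * (D1 * D1') *
          ((s - y + 3 * n + 6) * (E2 * E0)) * (y * (H2 * H0)) -
        (A1 * A1) * ((s + 2 * n + 5) * (B2 * B0)) * (C1 * C1') * (D1 * D1') *
          ((s - y + n + 4) * (E2 * E0)) * ((y + n + 1) * (H2 * H0)) := by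
      rw [hA, hC, hD]
      ring
    _ = _ := by
      rw [← hB, ← hB', ← hE, ← hE', ← hH, ← hH']
      ring

theorem factorialProduct_ne_zero {n s : ℕ} {y : ℤ} (hy : 0 ≤ y) (hd : 3 * (n : ℤ) ≤ 2 * y - s)
    (hx : 0 ≤ s - y + n + 2) : factorialProduct n s y ≠ 0 := by
  have hy' : (0 : ℚ) ≤ y := by exact_mod_cast hy
  have hd' : 3 * (n : ℚ) ≤ 2 * y - s := by exact_mod_cast hd
  unfold factorialProduct numFactor diffFactor sumFactor denFactor denFactor₂
  simp only [ne_eq, mul_eq_zero, not_or, Finset.prod_eq_zero_iff, not_exists, not_and,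
    Finset.mem_range]
  refine ⟨⟨⟨⟨⟨fun i _ => ?_, fun i _ => ?_⟩, fun i hi t ht => ?_⟩, fun i hi t ht => ?_⟩,
    fun i _ => ?_⟩, fun i _ => ?_⟩
  · exact Nat.cast_ne_zero.2 (Nat.factorial_ne_zero _)
  · exact Nat.cast_ne_zero.2 (Nat.factorial_ne_zero _)
  · have h1 : (t : ℚ) + 1 ≤ i := by exact_mod_cast ht
    have h2 : (i : ℚ) + 1 ≤ n := by exact_mod_cast hi
    exact ne_of_gt (by linarith)
  · positivity
  · exact invFactorial_ne_zero (by omega)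
  · exact invFactorial_ne_zero (by omega)

/-- The determinant of `factorialMatrix n s y` by condensation. The hypotheses are stable under the
shifts of the parameters; they ensure that the determinant of the interior matrix is not zero,
except when already the first row of the matrix vanishes. -/
theorem det_factorialMatrix (n s : ℕ) (y : ℤ) (hy : (n : ℤ) ≤ y + 1)
    (hd : 3 * (n : ℤ) ≤ 2 * y - s) :
    (factorialMatrix n s y).det = factorialProduct n s y := by
  induction n using Nat.twoStepInduction generalizing s y with
  | zero =>
    simp [factorialProduct, numFactor, diffFactor, sumFactor, denFactor, denFactor₂]
  | one =>
    simp [factorialProduct, numFactor, diffFactor, sumFactor, denFactor, denFactor₂,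
      factorialMatrix, factorialEntry, add_assoc]
  | more n ih0 ih1 =>
    push_cast at hy hd
    by_cases hx : 0 ≤ s - y + n + 5
    · have h := factorialMatrix_condensation n s y
      rw [ih0 _ _ (by omega) (by push_cast; omega),
        ih1 _ _ (by push_cast; omega) (by push_cast; omega),
        ih1 _ _ (by push_cast; omega) (by push_cast; omega),
        ih1 _ _ (by push_cast; omega) (by push_cast; omega),
        ih1 _ _ (by push_cast; omega) (by push_cast; omega), ← factorialProduct_condensation] at h
      refine mul_right_cancel₀ (factorialProduct_ne_zero (by omega) ?_ ?_) h
      · push_cast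
        omega
      · push_cast
        omega
    · -- The first row and the first factor of `denFactor` contain reciprocals of factorials of
      -- negative integers.
      have h1 : (factorialMatrix (n + 2) s y).det = 0 := by
        refine Matrix.det_eq_zero_of_row_eq_zero 0 fun l => ?_
        have := l.rev.isLt
        rw [factorialMatrix, Matrix.of_apply, factorialEntry, invFactorial_of_neg, mul_zero,
          zero_mul]
        simp only [Fin.val_zero]
        omega
      have h2 : denFactor (n + 2) (s - y) = 0 := by
        rw [denFactor_succ', invFactorial_of_neg, mul_zero]
        push_cast
        omega
      rw [h1, factorialProduct, h2]
      ring

/-! ### The region `H_d(a, b, c)` in terms of paths -/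

/-- The horizontal sides of the unit triangles of `H_d(a, b, c)`, each given by its left endpoint.
The bound `2 x + y < 2 b` comes from the removal of the eastern staircase, and
`y ≤ x + a + 2 c + 1 - b` from that of the northwestern one. -/
noncomputable def hexagonDSegments (a b c : ℕ) : Finset (ℤ × ℤ) :=
  (Finset.Icc (-(c : ℤ)) b ×ˢ Finset.Icc (0 : ℤ) (a + c)).filter fun p =>
    0 ≤ p.1 + p.2 ∧ p.1 + p.2 < a + b ∧ 2 * p.1 + p.2 < 2 * b ∧ p.2 ≤ p.1 + a + 2 * c + 1 - b

theorem mem_hexagonDSegments {a b c : ℕ} {x y : ℤ} :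
    (x, y) ∈ hexagonDSegments a b c ↔ (-(c : ℤ) ≤ x ∧ 0 ≤ y ∧ y ≤ a + c) ∧
      0 ≤ x + y ∧ x + y < a + b ∧ 2 * x + y < 2 * b ∧ y ≤ x + a + 2 * c + 1 - b := by
  simp only [hexagonDSegments, Finset.mem_filter, Finset.mem_product, Finset.mem_Icc]
  constructor <;> intro h <;> omega

/-- The starting points of the paths: the horizontal segments of the upper boundary of
`H_d(a, b, c)`. -/
def hexagonDStart (a b c : ℕ) (i : Fin b) : ℤ × ℤ :=
  (-c + i, a + c - b + 1 + i)

theorem hexagonDStart_strictMono (a b c : ℕ) : StrictMono (hexagonDStart a b c) := by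
  intro i j hij
  have : (i : ℤ) < j := by exact_mod_cast hij
  refine Prod.lt_iff.2 (Or.inl ⟨?_, ?_⟩) <;> simp only [hexagonDStart] <;> omega

theorem mem_range_hexagonDStart {a b c : ℕ} {x y : ℤ} :
    (x, y) ∈ Set.range (hexagonDStart a b c) ↔
      -(c : ℤ) ≤ x ∧ x < b - c ∧ y = x + a + 2 * c + 1 - b := by
  constructor
  · rintro ⟨i, h⟩
    simp only [hexagonDStart, Prod.mk.injEq] at h
    have := i.isLt
    omega
  · rintro ⟨h1, h2, rfl⟩
    refine ⟨⟨(x + c).toNat, by omega⟩, ?_⟩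
    simp only [hexagonDStart, Prod.mk.injEq]
    omega

theorem hexagonDStart_mem {a b c : ℕ} (hba : b ≤ a) (hac : a ≤ c) (i : Fin b) :
    hexagonDStart a b c i ∈ hexagonDSegments a b c := by
  have := i.isLt
  rw [hexagonDStart, mem_hexagonDSegments]
  omega

/-- Under the hypothesis `b ≤ a ≤ c`, the staircases have `b - 1` and `a - 1` rows and cut off the
whole part of the hexagon beyond the two lines that bound `hexagonDSegments`. -/
theorem hexagonD_eq_pathRegion {a b c : ℕ} (hba : b ≤ a) (hac : a ≤ c) :
    hexagonD a b c =
      pathRegion (hexagonDSegments a b c) (Set.range (hexagonDStart a b c)) := by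
  have hmin : min a b = b := min_eq_right hba
  have hmin' : min a c = a := min_eq_left hac
  ext (⟨x, y⟩ | ⟨x, y⟩)
  · have hnw : up x y ∈ northwestStaircase a b c ↔
        -(c : ℤ) ≤ x ∧ y < a + c ∧ x + a + 2 * c + 1 - b ≤ y := by
      simp only [northwestStaircase, Set.mem_ofPred_eq, up.injEq, reduceCtorEq, or_false, hmin]
      constructor
      · rintro ⟨r, s, h, rfl, rfl⟩
        omega
      · rintro ⟨h1, h2, h3⟩
        exact ⟨(x + c).toNat, (a + c - 1 - y).toNat, by omega⟩
    have he : up x y ∈ eastStaircase a b c ↔ x < b ∧ x + y < a + b ∧ 2 * b ≤ 2 * x + y := by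
      simp only [eastStaircase, Set.mem_ofPred_eq, up.injEq, reduceCtorEq, or_false, hmin']
      constructor
      · rintro ⟨r, s, h, rfl, rfl⟩
        omega
      · rintro ⟨h1, h2, h3⟩
        exact ⟨(a + b - 1 - x - y).toNat, (b - 1 - x).toNat, by omega⟩
    rw [up_mem_pathRegion, Finset.mem_coe, mem_hexagonDSegments, mem_range_hexagonDStart, hexagonD,
      Set.mem_sdiff, Set.mem_union, hnw, he]
    simp only [hexagon, hexagonPoints, vertices, Set.mem_ofPred_eq, Finset.mem_insert,
      Finset.mem_singleton, forall_eq_or_imp, forall_eq]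
    omega
  · have hnw : down x y ∈ northwestStaircase a b c ↔
        -(c : ℤ) ≤ x ∧ y < a + c ∧ x + a + 2 * c + 1 - b ≤ y := by
      simp only [northwestStaircase, Set.mem_ofPred_eq, down.injEq, reduceCtorEq, false_or, hmin]
      constructor
      · rintro ⟨r, s, h, rfl, rfl⟩
        omega
      · rintro ⟨h1, h2, h3⟩
        exact ⟨(x + c).toNat, (a + c - 1 - y).toNat, by omega⟩
    have he : down x y ∈ eastStaircase a b c ↔
        x < b ∧ x + y + 1 < a + b ∧ 2 * b ≤ 2 * x + y + 1 := by
      simp only [eastStaircase, Set.mem_ofPred_eq, down.injEq, reduceCtorEq, false_or, hmin']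
      constructor
      · rintro ⟨r, s, h, rfl, rfl⟩
        omega
      · rintro ⟨h1, h2, h3⟩
        exact ⟨(a + b - 2 - x - y).toNat, (b - 1 - x).toNat, by omega⟩
    rw [down_mem_pathRegion, Finset.mem_coe, mem_hexagonDSegments, hexagonD,
      Set.mem_sdiff, Set.mem_union, hnw, he]
    simp only [hexagon, hexagonPoints, vertices, Set.mem_ofPred_eq, Finset.mem_insert,
      Finset.mem_singleton, forall_eq_or_imp, forall_eq]
    omega

/-- The number `binom(y + 2r + 1, b - x + r) - binom(y + 2r + 1, b - x + r + 1)`, where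
`r = b - 1 - j`. By the reflection principle, this is the number of paths with steps `(0, -1)` and
`(1, -1)` from `p = (x, y)` to `(b + r, -(2r + 1))` that do not meet the line `2 x + y = 2 b`. These
targets, next to that line and below the hexagon, are taken in place of the segments of the bottom
side because the difference of binomial coefficients is then a single hypergeometric term, by
`choose_sub_choose_succ`. -/
def wallPathCount (b : ℕ) (p : ℤ × ℤ) (j : Fin b) : ℤ :=
  ((p.2 + 2 * (j.rev : ℕ) + 1).toNat.choose (b - p.1 + (j.rev : ℕ)).toNat : ℤ) -
    (p.2 + 2 * (j.rev : ℕ) + 1).toNat.choose (b - p.1 + (j.rev : ℕ) + 1).toNat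

theorem wallPathCount_eq_add {b : ℕ} {x y : ℤ} (hx : x < b) (hy : 0 < y) :
    wallPathCount b (x, y) = wallPathCount b (x, y - 1) + wallPathCount b (x + 1, y - 1) := by
  ext j
  simp only [wallPathCount, Pi.add_apply]
  generalize (j.rev : ℕ) = r
  rw [show (y + 2 * r + 1).toNat = (y - 1 + 2 * r + 1).toNat + 1 by omega,
    show (b - x + r).toNat = (b - (x + 1) + r).toNat + 1 by omega,
    show (b - x + r + 1).toNat = (b - (x + 1) + r).toNat + 2 by omega,
    show (b - (x + 1) + r + 1).toNat = (b - (x + 1) + r).toNat + 1 by omega,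
    Nat.choose_succ_succ, Nat.choose_succ_succ]
  push_cast
  ring

theorem wallPathCount_eq_zero_of_wall {b : ℕ} {x y : ℤ} (hy : 0 ≤ y) (h : 2 * x + y = 2 * b) :
    wallPathCount b (x, y) = 0 := by
  ext j
  simp only [wallPathCount, Pi.zero_apply]
  generalize (j.rev : ℕ) = r
  rw [sub_eq_zero, Nat.cast_inj]
  exact Nat.choose_symm_of_eq_add (by omega)

theorem wallPathCount_eq_zero_of_left {b : ℕ} {x y : ℤ} (hy : 0 ≤ y) (h : x + y < 0) :
    wallPathCount b (x, y) = 0 := by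
  ext j
  have := j.rev.isLt
  simp only [wallPathCount, Pi.zero_apply]
  rw [Nat.choose_eq_zero_of_lt (by omega), Nat.choose_eq_zero_of_lt (by omega), sub_self]

/-- The matrix is lower unitriangular. -/
theorem det_wallPathCount (b : ℕ) :
    (Matrix.of fun i : Fin b => wallPathCount b ((i : ℤ), 0)).det = 1 := by
  rw [Matrix.det_of_isLowerTriangular]
  · refine Finset.prod_eq_one fun i _ => ?_
    have := i.isLt
    simp only [Matrix.of_apply, wallPathCount, Fin.val_rev]
    rw [show (b - i + ((b - (i + 1) : ℕ) : ℤ)).toNat =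
        (0 + 2 * ((b - (i + 1) : ℕ) : ℤ) + 1).toNat by omega, Nat.choose_self,
      Nat.choose_eq_zero_of_lt (by omega)]
    simp
  · intro i j hij
    have hij' : i < j := hij
    have h : (i : ℕ) < j := hij'
    have := j.isLt
    simp only [Matrix.of_apply, wallPathCount, Fin.val_rev]
    rw [Nat.choose_eq_zero_of_lt (by omega), Nat.choose_eq_zero_of_lt (by omega), sub_self]

theorem numLozengeTilings_hexagonD {a b c : ℕ} (hba : b ≤ a) (hac : a ≤ c) :
    (numLozengeTilings (hexagonD a b c) : ℤ) =
      (Matrix.of fun i => wallPathCount b (hexagonDStart a b c i)).det := by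
  rw [hexagonD_eq_pathRegion hba hac]
  refine numLozengeTilings_pathRegion (det_wallPathCount b) ?_ ?_ ?_ ?_
    (hexagonDStart_strictMono a b c) (hexagonDStart_mem hba hac)
  · rintro ⟨x, y⟩ h
    rw [mem_hexagonDSegments] at h
    exact h.1.2.1
  · intro x
    rw [mem_hexagonDSegments]
    omega
  · rintro ⟨x, y⟩ h hy
    rw [mem_hexagonDSegments] at h
    dsimp only at hy
    exact wallPathCount_eq_add (by omega) hy
  · rintro ⟨x, y⟩ h hy ⟨x', y'⟩ hw hwV
    rw [mem_hexagonDSegments] at h hwV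
    simp only [Prod.mk.injEq] at hw hy
    by_cases h' : x' + y' < 0
    · exact wallPathCount_eq_zero_of_left (by omega) h'
    · exact wallPathCount_eq_zero_of_wall (by omega) (by omega)

/-! ### The product formula -/

theorem choose_sub_choose_succ (N k : ℕ) :
    (N.choose k : ℚ) - N.choose (k + 1) =
      (2 * k + 1 - N) * (N.factorial * invFactorial (N - k) * invFactorial (k + 1)) := by
  have hk := invFactorial_natCast (k + 1)
  push_cast at hk
  rcases lt_trichotomy N k with h | rfl | h
  · rw [Nat.choose_eq_zero_of_lt h, Nat.choose_eq_zero_of_lt (by omega),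
      invFactorial_of_neg (m := N - k) (by omega)]
    simp
  · have h0 : (N.factorial : ℚ) ≠ 0 := Nat.cast_ne_zero.2 (Nat.factorial_ne_zero _)
    rw [Nat.choose_self, Nat.choose_eq_zero_of_lt (by omega), hk, sub_self,
      show invFactorial 0 = 1 by simpa using invFactorial_natCast 0, Nat.factorial_succ]
    have h1 : (N : ℚ) + 1 ≠ 0 := by positivity
    push_cast
    field_simp
    ring
  · obtain ⟨m, rfl⟩ : ∃ m, N = k + 1 + m := ⟨N - k - 1, by omega⟩
    have hm := invFactorial_natCast (m + 1)
    rw [show ((k + 1 + m : ℕ) - k : ℤ) = (m + 1 : ℕ) by push_cast; ring, hm, hk,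
      Nat.cast_choose ℚ (by omega : k ≤ k + 1 + m),
      Nat.cast_choose ℚ (by omega : k + 1 ≤ k + 1 + m), show k + 1 + m - k = m + 1 by omega,
      show k + 1 + m - (k + 1) = m by omega, Nat.factorial_succ m, Nat.factorial_succ k]
    have h0 : (m.factorial : ℚ) ≠ 0 := Nat.cast_ne_zero.2 (Nat.factorial_ne_zero _)
    have h1 : (k.factorial : ℚ) ≠ 0 := Nat.cast_ne_zero.2 (Nat.factorial_ne_zero _)
    push_cast
    field_simp
    ring

theorem wallPathCount_hexagonDStart {a b c : ℕ} (hba : b ≤ a) (i j : Fin b) :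
    (wallPathCount b (hexagonDStart a b c i) j : ℚ) =
      (3 * b + c - a - 3 * i - 1) *
        factorialMatrix b (a + c - b) (b + c + 1) i j := by
  have hi := i.isLt
  simp only [wallPathCount, hexagonDStart, factorialMatrix, Matrix.of_apply, factorialEntry]
  generalize (j.rev : ℕ) = r
  rw [show ((a : ℤ) + c - b + 1 + i + 2 * r + 1).toNat = a + c - b + i + 2 * r + 2 by omega,
    show ((b : ℤ) - (-c + i) + r).toNat = b + c - i + r by omega,
    show ((b : ℤ) - (-c + i) + r + 1).toNat = b + c - i + r + 1 by omega]
  push_cast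
  rw [choose_sub_choose_succ]
  have h1 : ((a + c - b : ℕ) : ℚ) = a + c - b := by
    rw [Nat.cast_sub (by omega)]
    push_cast
    ring
  have h2 : ((b + c - i : ℕ) : ℚ) = b + c - i := by
    rw [Nat.cast_sub (by omega)]
    push_cast
    ring
  congr 1
  · push_cast
    rw [h1, h2]
    ring
  · congr 2
    · congr 1
      omega
    · omega

open Finset in
theorem prod_mul_factorialProduct {a b c : ℕ} (hba : b ≤ a) :
    (∏ i ∈ range b, (3 * b + c - a - 3 * i - 1 : ℚ)) *
        factorialProduct b (a + c - b) (b + c + 1) =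
      (-1) ^ (b * (b + 1) / 2) * tilingProduct b ((a : ℤ) - 2 * b - 1) ((b : ℤ) + c + 1) := by
  have h1 : ((a + c - b : ℕ) : ℚ) = a + c - b := by
    rw [Nat.cast_sub (by omega)]
    push_cast
    ring
  have hsign : (-1 : ℚ) ^ (b * (b + 1) / 2) = ∏ i ∈ range b, (-1 : ℚ) ^ (1 + i) := by
    have h := sum_range_id (b + 1)
    rw [sum_range_succ', Nat.add_sub_cancel, mul_comm, add_zero] at h
    rw [prod_pow_eq_pow_sum, ← h]
    simp only [add_comm]
  have hden : denFactor₂ b (b + c + 1) =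
      ∏ i ∈ range b, invFactorial (b + c + 1 + (b - 1 - i : ℕ)) := by
    rw [denFactor₂, ← prod_range_reflect]
  rw [tilingProduct, ← Finset.Ico_add_one_right_eq_Icc, prod_Ico_eq_prod_range,
    Nat.add_sub_cancel, hsign, factorialProduct, hden]
  simp only [numFactor, diffFactor, sumFactor, denFactor, ← prod_mul_distrib]
  refine prod_congr rfl fun i hi => ?_
  have hi' := mem_range.1 hi
  -- The row factor `3 b + c - a - 3 i - 1` extends the product in `diffFactor` by one factor.
  have hdiff : (3 * b + c - a - 3 * i - 1 : ℚ) *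
      ∏ t ∈ range i, (2 * ((b : ℤ) + c + 1 : ℤ) - (a + c - b : ℕ) - 2 * i - 3 - t : ℚ) =
      (-1) ^ (1 + i) * shiftedFactorial (((a : ℤ) - 2 * b - 1 : ℤ) - ((b : ℤ) + c + 1 : ℤ) +
        2 * (1 + i : ℕ) + 1) (1 + i) := by
    have h := prod_range_succ
      (fun t : ℕ => (2 * ((b : ℤ) + c + 1 : ℤ) - (a + c - b : ℕ) - 2 * i - 3 - t : ℚ)) i
    rw [shiftedFactorial, ← card_range (1 + i), ← prod_const, card_range, ← prod_mul_distrib,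
      add_comm 1 i, mul_comm]
    refine Eq.trans ?_ (h.symm.trans (prod_congr rfl fun t _ => ?_))
    · congr 1
      rw [h1]
      push_cast
      ring
    · rw [h1]
      push_cast
      ring
  have hsum : ∏ t ∈ range (b - 1 - i),
      ((a + c - b : ℕ) + ((b : ℤ) + c + 1 : ℤ) + 3 * i + 4 + t : ℚ) =
      shiftedFactorial (((a : ℤ) - 2 * b - 1 : ℤ) + 2 * ((b : ℤ) + c + 1 : ℤ) +
        3 * (1 + i : ℕ) + 1) (b - (1 + i)) := by
    rw [shiftedFactorial, Nat.sub_sub]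
    refine prod_congr rfl fun t _ => ?_
    rw [h1]
    push_cast
    ring
  rw [show ((a : ℤ) - 2 * b - 1 + (b + c + 1) + 2 * (1 + i : ℕ)).toNat = a + c - b + 2 * i + 2 by
      omega, Nat.add_sub_cancel_left, ← hsum]
  have hx : invFactorial ((a + c - b : ℕ) - (b + c + 1) + b + 2 * i + 2) =
      (((a : ℤ) - 2 * b - 1 + b + 2 * (1 + i : ℕ)).toNat.factorial : ℚ)⁻¹ := by
    rw [← invFactorial_natCast]
    congr 1
    omega
  have hy : invFactorial (b + c + 1 + (b - 1 - i : ℕ)) =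
      (((b : ℤ) + c + 1 + b - (1 + i : ℕ)).toNat.factorial : ℚ)⁻¹ := by
    rw [← invFactorial_natCast]
    congr 1
    omega
  rw [hx, hy, div_eq_mul_inv, mul_inv]
  linear_combination (i.factorial : ℚ) * (a + c - b + 2 * i + 2).factorial *
    (∏ t ∈ range (b - 1 - i), ((a + c - b : ℕ) + ((b : ℤ) + c + 1 : ℤ) + 3 * i + 4 + t : ℚ)) *
    (((a : ℤ) - 2 * b - 1 + b + 2 * (1 + i : ℕ)).toNat.factorial : ℚ)⁻¹ *
    (((b : ℤ) + c + 1 + b - (1 + i : ℕ)).toNat.factorial : ℚ)⁻¹ * hdiff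

theorem theorem1p1 (a b c : ℕ) (hba : b ≤ a) (hac : a ≤ c) :
    (numLozengeTilings (hexagonD a b c) : ℚ) =
      (-1) ^ (b * (b + 1) / 2) * tilingProduct b ((a : ℤ) - 2 * b - 1) ((b : ℤ) + c + 1) := by
  have h := congrArg (Int.cast : ℤ → ℚ) (numLozengeTilings_hexagonD hba hac)
  have hM : (Int.castRingHom ℚ).mapMatrix
      (Matrix.of fun i => wallPathCount b (hexagonDStart a b c i)) =
      Matrix.of fun i j : Fin b => (3 * b + c - a - 3 * (i : ℕ) - 1 : ℚ) *
        factorialMatrix b (a + c - b) (b + c + 1) i j := by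
    ext i j
    exact wallPathCount_hexagonDStart hba i j
  rw [Int.cast_natCast, ← eq_intCast (Int.castRingHom ℚ), RingHom.map_det, hM,
    Matrix.det_mul_column, det_factorialMatrix _ _ _ (by omega) (by omega),
    Fin.prod_univ_eq_prod_range (fun i : ℕ => (3 * b + c - a - 3 * i - 1 : ℚ)) b] at h
  rw [h, prod_mul_factorialProduct hba]
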